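/- Let $0<p\le q<1$ with $p+q\ne 1$, let $\lambda\ge 0$, let $H(x)=-x\log_2 x-(1-x)\log_2(1-x)$ and $\tau(\omega)=p+\omega(1-p-q)$. Consider the Markov decision process on the belief space $(0,1)$ with actions $u\in\{0,1\}$: in belief $\omega$ the active action $u=1$ leads to $1-q$ with probability $\omega$ and to $p$ with probability $1-\omega$, the passive action $u=0$ leads to $\tau(\omega)$, and the penalty of a slot is $H(\omega)+\lambda u$. The long-run expected average penalty is to be minimized over all (history-dependent, randomized) policies. The average-penalty Bellman equation $$V(\omega)+g=H(\omega)+\min\{\lambda+\omega V(1-q)+(1-\omega)V(p),\;V(\tau(\omega))\},\qquad \omega\in(0,1),$$ has a solution consisting of a constant $g$ and a function $V$ continuous on $(0,1)$ with $V(p)=0$. For every such solution put $a(\omega)=\lambda+\omega V(1-q)$ and $r(\omega)=V(\tau(\omega))$ for $\omega\in[0,1]$. Then there are thresholds $0\le\omega^l\le\omega^u\le1$ such that: 1. the stationary policy that is active exactly when $\omega\in(\omega^l,\omega^u)$ is optimal: from every initial belief in $(0,1)$ its expected average penalty converges to $g$, and the limit inferior of the expected average penalty of any policy is at least $g$; 2.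 for $\omega\in(0,1)$ one has $\omega\in(\omega^l,\omega^u)$ if and only if $a(\omega)<r(\omega)$; 3. $a(\omega^l)=r(\omega^l)$ and $a(\omega^u)=r(\omega^u)$, unless $a>r$ on all of $[0,1]$ (in which case the interval $(\omega^l,\omega^u)$ is empty); 4. if $(\omega^l,\omega^u)$ is empty, this policy is the never-sample policy, which is passive in every belief state. -/

import Mathlib

open Filter Topology

noncomputable section

/-- The belief state space `(0,1)`. -/
abbrev Belief : Type := Set.Ioo (0 : ℝ) 1

/-- The binary entropy function in bits. -/
def entropy2 (x : ℝ) : ℝ := -x * Real.logb 2 x - (1 - x) * Real.logb 2 (1 - x)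

/-- The parameters of a single bandit: a binary Markov chain that jumps from 0 to 1 with
probability `p` and from 1 to 0 with probability `q`. -/
structure Bandit where
  p : ℝ
  q : ℝ
  p_pos : 0 < p
  p_le_q : p ≤ q
  q_lt_one : q < 1
  p_add_q_ne_one : p + q ≠ 1

namespace Bandit

variable (B : Bandit)

/-- One-step evolution of the belief without observation. -/
def tau (x : ℝ) : ℝ := B.p + x * (1 - B.p - B.q)

lemma tau_mem {x : ℝ} (hx : x ∈ Set.Icc (0 : ℝ) 1) : B.tau x ∈ Set.Ioo (0 : ℝ) 1 := by
  obtain ⟨h0, h1⟩ := hx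
  have hp := B.p_pos
  have hpq := B.p_le_q
  have hq := B.q_lt_one
  unfold tau
  constructor
  · nlinarith [mul_nonneg (sub_nonneg.2 h1) hp.le, mul_nonneg h0 (sub_nonneg.2 hq.le)]
  · nlinarith [mul_nonneg (sub_nonneg.2 h1) (sub_nonneg.2 (hpq.trans hq.le)),
      mul_nonneg h0 (hp.le.trans hpq)]

/-- The belief after the active action has revealed state 0. -/
def beliefP : Belief := ⟨B.p, B.p_pos, B.p_le_q.trans_lt B.q_lt_one⟩

/-- The belief after the active action has revealed state 1. -/
def beliefQ : Belief :=
  ⟨1 - B.q, sub_pos.2 B.q_lt_one, sub_lt_self 1 (B.p_pos.trans_le B.p_le_q)⟩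

/-- The belief after the passive action. -/
def beliefTau (w : Belief) : Belief := ⟨B.tau w, B.tau_mem ⟨w.2.1.le, w.2.2.le⟩⟩

/-- The law of the state of the chain under the belief `w`: `true` (state 1) has probability `w`
and `false` (state 0) has probability `1 - w`. -/
def stateLaw (w : Belief) : PMF Bool :=
  PMF.ofFintype (fun s => ENNReal.ofReal (if s then (w : ℝ) else 1 - w)) (by
    rw [Fintype.sum_bool, ← ENNReal.ofReal_add] <;> simp [w.2.1.le, w.2.2.le])

/-- Controlled transition law of the belief; `true` is the active action: it leads to `1 - q`
with probability `w` and to `p` with probability `1 - w`. The passive action leads to `τ(w)`. -/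
def transition (w : Belief) (u : Bool) : PMF Belief :=
  if u then (stateLaw w).map fun s => if s then B.beliefQ else B.beliefP
  else PMF.pure (B.beliefTau w)

/-- A (history-dependent, randomized) policy: the law of the action, given the list of all past
(belief, action) pairs, most recent first, and the current belief. -/
abbrev Policy : Type := List (Belief × Bool) → Belief → PMF Bool

/-- Joint law of the past (belief, action) pairs and of the current belief after `t` slots,
under the policy `π` and from the initial belief `w₀`. -/
def historyLaw (π : Policy) (w₀ : Belief) : ℕ → PMF (List (Belief × Bool) × Belief)
  | 0 => PMF.pure ([], w₀)
  | t + 1 => (historyLaw π w₀ t).bind fun x =>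
      (π x.1 x.2).bind fun u =>
        (B.transition x.2 u).map fun w' => ((x.2, u) :: x.1, w')

/-- Joint law of the belief and of the action in slot `t`. -/
def slotLaw (π : Policy) (w₀ : Belief) (t : ℕ) : PMF (Belief × Bool) :=
  (B.historyLaw π w₀ t).bind fun x => (π x.1 x.2).map fun u => (x.2, u)

/-- Penalty of a slot: the entropy of the belief, plus the service charge if active. -/
def penalty (lam : ℝ) (z : Belief × Bool) : ℝ :=
  entropy2 z.1 + lam * (if z.2 then 1 else 0)

/-- Expected penalty in slot `t` (the penalty is bounded, so the series converges). -/
def expectedPenalty (lam : ℝ) (π : Policy) (w₀ : Belief) (t : ℕ) : ℝ :=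
  ∑' z : Belief × Bool, (B.slotLaw π w₀ t z).toReal * penalty lam z

/-- Expected average penalty over the first `T` slots. -/
def averagePenalty (lam : ℝ) (π : Policy) (w₀ : Belief) (T : ℕ) : ℝ :=
  (∑ t ∈ Finset.range T, B.expectedPenalty lam π w₀ t) / T

/-- `π` is average-optimal with optimal average penalty `g`: from every initial belief, its
average penalty converges to `g`, and no policy has a smaller limit inferior. -/
def IsAverageOptimal (lam : ℝ) (π : Policy) (g : ℝ) : Prop :=
  ∀ w₀ : Belief,
    Tendsto (fun T => B.averagePenalty lam π w₀ T) atTop (𝓝 g) ∧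
    ∀ π' : Policy, ∀ ε > 0, ∀ᶠ T in atTop, g - ε ≤ B.averagePenalty lam π' w₀ T

/-- `V` (only its values on `(0,1)` matter) and the constant `g` solve the Bellman equation of
the average-penalty problem, `V` is continuous on `(0,1)`, and `V` is normalized by `V(p) = 0`. -/
structure IsBellmanSolution (lam : ℝ) (V : ℝ → ℝ) (g : ℝ) : Prop where
  continuousOn : ContinuousOn V (Set.Ioo 0 1)
  normalized : V B.p = 0
  bellman : ∀ w ∈ Set.Ioo (0 : ℝ) 1,
    V w + g = entropy2 w +
      min (lam + w * V (1 - B.q) + (1 - w) * V B.p) (V (B.tau w))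

/-- Active cost (for `V(p) = 0`). -/
def activeCost (lam : ℝ) (V : ℝ → ℝ) (w : ℝ) : ℝ := lam + w * V (1 - B.q)

/-- Passive cost. -/
def passiveCost (V : ℝ → ℝ) (w : ℝ) : ℝ := V (B.tau w)

open Classical in
/-- The stationary policy that is active exactly in `(l, u)`. -/
def thresholdPolicy (l u : ℝ) : Policy :=
  fun _ w => PMF.pure (decide ((w : ℝ) ∈ Set.Ioo l u))

/-- The policy that is passive in every belief state. -/
def neverSample : Policy := fun _ _ => PMF.pure false

end Bandit

end

/-!
Every solution `V` of the Bellman equation is concave on `(0,1)`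
(`Bandit.IsBellmanSolution.concaveOn`). Write `τ` for the passive flow. The active cost is affine
and the entropy is concave, so a positive concavity defect of `V` at a pair of beliefs can only
come from the passive branch, and then it is at most the defect at the images of the pair under
`τ`. Since `τ` contracts to the stationary belief, where `V` is continuous, a positive defect is
impossible. No uniqueness of `V` is used.

Hence the passive cost minus the active cost is concave on `[0,1]`, and it equals `-lam ≤ 0` at
both end points. The set where it is positive is therefore an interval between two of its zeros
(`exists_thresholds`). The policy that is active on this interval always plays a minimizing action
of the Bellman equation. Taking expectations and telescoping, `V` being bounded because `τ` maps
`[0,1]` into a compact part of `(0,1)`, its average penalty tends to `g`, while that of any other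
policy is at least `g - O(1/T)` (`Bandit.IsBellmanSolution.isAverageOptimal`).

A solution exists by vanishing discount (`Bandit.exists_isBellmanSolution`). The discounted value
functions are concave limits of value iteration. Their differences to the value at `p` are bounded
uniformly in the discount factor (`Bandit.exists_relative_discounted`), so they converge pointwise
along an ultrafilter; the limit is concave, hence continuous, and the equation passes to the limit.
-/

/-! ### Entropy, the passive flow and concave functions -/

lemma concaveOn_of_tendsto {ι : Type*} {l : Filter ι} [l.NeBot] {s : Set ℝ} {F : ι → ℝ → ℝ}
    {f : ℝ → ℝ} (hs : Convex ℝ s) (hF : ∀ i, ConcaveOn ℝ s (F i))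
    (h : ∀ x ∈ s, Tendsto (fun i => F i x) l (𝓝 (f x))) : ConcaveOn ℝ s f := by
  refine ⟨hs, fun x hx y hy a b ha hb hab => ?_⟩
  refine le_of_tendsto_of_tendsto' (((h x hx).const_smul a).add ((h y hy).const_smul b))
    (h _ (hs hx hy ha hb hab)) fun i => (hF i).2 hx hy ha hb hab

/-- The positivity set of a concave function that is nonpositive at both ends of `[0,1]` is an
open interval, whose end points are zeros of the function as soon as it reaches `0` at all. -/
lemma exists_thresholds {f : ℝ → ℝ} (hf : ConcaveOn ℝ (Set.Icc 0 1) f)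
    (hc : ContinuousOn f (Set.Icc 0 1)) (h0 : f 0 ≤ 0) (h1 : f 1 ≤ 0) :
    ∃ l u : ℝ, 0 ≤ l ∧ l ≤ u ∧ u ≤ 1 ∧
      (∀ w ∈ Set.Ioo (0 : ℝ) 1, w ∈ Set.Ioo l u ↔ 0 < f w) ∧
      ((∃ w ∈ Set.Icc (0 : ℝ) 1, 0 ≤ f w) → f l = 0 ∧ f u = 0) := by
  by_cases hpos : ∃ c ∈ Set.Icc (0 : ℝ) 1, 0 < f c
  · obtain ⟨c, hcI, hcp⟩ := hpos
    obtain ⟨l, hl, hfl⟩ := intermediate_value_Icc hcI.1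
      (hc.mono (Set.Icc_subset_Icc_right hcI.2)) ⟨h0, hcp.le⟩
    obtain ⟨u, hu, hfu⟩ := intermediate_value_Icc' hcI.2
      (hc.mono (Set.Icc_subset_Icc_left hcI.1)) ⟨h1, hcp.le⟩
    have hlI : l ∈ Set.Icc (0 : ℝ) 1 := ⟨hl.1, hl.2.trans hcI.2⟩
    have huI : u ∈ Set.Icc (0 : ℝ) 1 := ⟨hcI.1.trans hu.1, hu.2⟩
    have hlc : l < c := lt_of_le_of_ne hl.2 (by rintro rfl; exact hcp.ne' hfl)
    have hcu : c < u := lt_of_le_of_ne hu.1 (by rintro rfl; exact hcp.ne' hfu)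
    -- Strictly between a point where `f` is nonnegative and one where it is positive, `f > 0`.
    have key : ∀ x ∈ Set.Icc (0 : ℝ) 1, ∀ y ∈ Set.Icc (0 : ℝ) 1, ∀ z ∈ openSegment ℝ x y,
        0 ≤ f x → 0 < f y → 0 < f z := by
      rintro x hx y hy z ⟨a, b, ha, hb, hab, rfl⟩ hfx hfy
      have := hf.2 hx hy ha.le hb.le hab
      simp only [smul_eq_mul] at this ⊢
      nlinarith [mul_nonneg ha.le hfx, mul_pos hb hfy]
    refine ⟨l, u, hl.1, (hlc.trans hcu).le, hu.2, fun w hw => ⟨fun hwI => ?_, fun hfw => ?_⟩,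
      fun _ => ⟨hfl, hfu⟩⟩
    · rcases lt_trichotomy w c with h | rfl | h
      · exact key l hlI c hcI w (by rw [openSegment_eq_Ioo hlc]; exact ⟨hwI.1, h⟩) hfl.ge hcp
      · exact hcp
      · exact key u huI c hcI w
          (by rw [openSegment_symm, openSegment_eq_Ioo hcu]; exact ⟨h, hwI.2⟩) hfu.ge hcp
    · have hwI : w ∈ Set.Icc (0 : ℝ) 1 := ⟨hw.1.le, hw.2.le⟩
      constructor
      · by_contra! hle
        rcases hle.eq_or_lt with rfl | hlt
        · exact hfw.ne' hfl
        · exact (key w hwI c hcI l (by rw [openSegment_eq_Ioo (hlt.trans hlc)]; exact ⟨hlt, hlc⟩)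
            hfw.le hcp).ne' hfl
      · by_contra! hle
        rcases hle.eq_or_lt with rfl | hlt
        · exact hfw.ne' hfu
        · exact (key c hcI w hwI u (by rw [openSegment_eq_Ioo (hcu.trans hlt)]; exact ⟨hcu, hlt⟩)
            hcp.le hfw).ne' hfu
  · push Not at hpos
    have hempty : ∀ x, ∀ w ∈ Set.Ioo (0 : ℝ) 1, w ∈ Set.Ioo x x ↔ 0 < f w := fun x w hw => by
      simpa using hpos w ⟨hw.1.le, hw.2.le⟩
    by_cases hz : ∃ w ∈ Set.Icc (0 : ℝ) 1, 0 ≤ f w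
    · obtain ⟨w, hw, hfw⟩ := hz
      have := le_antisymm (hpos w hw) hfw
      exact ⟨w, w, hw.1, le_rfl, hw.2, hempty w, fun _ => ⟨this, this⟩⟩
    · exact ⟨0, 0, le_rfl, le_rfl, zero_le_one, hempty 0, fun h => absurd h hz⟩

lemma entropy2_eq_binEntropy_div (x : ℝ) : entropy2 x = Real.binEntropy x / Real.log 2 := by
  simp only [entropy2, Real.logb, Real.binEntropy, Real.log_inv]
  ring

lemma entropy2_nonneg {x : ℝ} (hx : x ∈ Set.Ioo (0 : ℝ) 1) : 0 ≤ entropy2 x := by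
  rw [entropy2_eq_binEntropy_div]
  exact div_nonneg (Real.binEntropy_nonneg hx.1.le hx.2.le) (Real.log_nonneg one_le_two)

lemma entropy2_le_one (x : ℝ) : entropy2 x ≤ 1 := by
  rw [entropy2_eq_binEntropy_div]
  exact div_le_one_of_le₀ Real.binEntropy_le_log_two (Real.log_nonneg one_le_two)

lemma concaveOn_entropy2 : ConcaveOn ℝ (Set.Ioo 0 1) entropy2 := by
  have h := (Real.strictConcave_binEntropy.concaveOn.subset Set.Ioo_subset_Icc_self
    (convex_Ioo 0 1)).smul (inv_nonneg.2 (Real.log_nonneg one_le_two))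
  refine h.congr fun x _ => ?_
  simp only [smul_eq_mul]
  rw [entropy2_eq_binEntropy_div, div_eq_inv_mul]

namespace Bandit

variable (B : Bandit)

lemma p_mem : B.p ∈ Set.Ioo (0 : ℝ) 1 := B.beliefP.2

lemma one_sub_q_mem : 1 - B.q ∈ Set.Ioo (0 : ℝ) 1 := B.beliefQ.2

lemma tau_mem_Ioo {x : ℝ} (hx : x ∈ Set.Ioo (0 : ℝ) 1) : B.tau x ∈ Set.Ioo (0 : ℝ) 1 :=
  B.tau_mem (Set.Ioo_subset_Icc_self hx)

lemma tau_eq_combination (x : ℝ) : B.tau x = x * (1 - B.q) + (1 - x) * B.p := by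
  unfold tau; ring

lemma tau_combination (x y : ℝ) {a b : ℝ} (hab : a + b = 1) :
    B.tau (a * x + b * y) = a * B.tau x + b * B.tau y := by
  obtain rfl : b = 1 - a := by linarith
  unfold tau; ring

lemma continuous_tau : Continuous B.tau := by
  unfold tau; fun_prop

lemma concaveOn_comp_tau {V : ℝ → ℝ} (hV : ConcaveOn ℝ (Set.Ioo 0 1) V) :
    ConcaveOn ℝ (Set.Icc 0 1) fun x => V (B.tau x) := by
  refine ⟨convex_Icc 0 1, fun x hx y hy a b ha hb hab => ?_⟩
  have := hV.2 (B.tau_mem hx) (B.tau_mem hy) ha hb hab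
  simp only [smul_eq_mul] at this ⊢
  rwa [B.tau_combination x y hab]

/-- The passive flow is a contraction towards the stationary probability `p / (p + q)`. -/
lemma tendsto_iterate_tau (x : ℝ) :
    Tendsto (fun n => B.tau^[n] x) atTop (𝓝 (B.p / (B.p + B.q))) := by
  have hp := B.p_pos
  have hpq := B.p_le_q
  have hq := B.q_lt_one
  have hne : B.p + B.q ≠ 0 := by linarith
  have heq : ∀ n, B.tau^[n] x = (1 - B.p - B.q) ^ n * (x - B.p / (B.p + B.q))
      + B.p / (B.p + B.q) := by
    intro n
    induction n with
    | zero => simp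
    | succ n ih =>
      rw [Function.iterate_succ_apply', ih, tau]
      field_simp
      ring
  simp only [heq]
  have hlim := tendsto_pow_atTop_nhds_zero_of_abs_lt_one
    (r := 1 - B.p - B.q) (abs_lt.2 ⟨by linarith, by linarith⟩)
  simpa using (hlim.mul_const (x - B.p / (B.p + B.q))).add_const (B.p / (B.p + B.q))

lemma stationary_mem : B.p / (B.p + B.q) ∈ Set.Ioo (0 : ℝ) 1 := by
  have hp := B.p_pos
  have hpq := B.p_le_q
  refine ⟨by apply div_pos <;> linarith, ?_⟩
  rw [div_lt_one] <;> linarith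

lemma iterate_tau_mem {x : ℝ} (hx : x ∈ Set.Ioo (0 : ℝ) 1) (n : ℕ) :
    B.tau^[n] x ∈ Set.Ioo (0 : ℝ) 1 := by
  induction n with
  | zero => exact hx
  | succ n ih => rw [Function.iterate_succ_apply']; exact B.tau_mem_Ioo ih

/-! ### Solutions of the Bellman equation are concave and bounded -/

variable {B} {lam : ℝ} {V : ℝ → ℝ} {g : ℝ}

lemma IsBellmanSolution.eq (h : B.IsBellmanSolution lam V g) {w : ℝ}
    (hw : w ∈ Set.Ioo (0 : ℝ) 1) :
    V w + g = entropy2 w + min (B.activeCost lam V w) (B.passiveCost V w) := by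
  have := h.bellman w hw
  rwa [h.normalized, mul_zero, add_zero] at this

/-- Every solution is concave. At a point where the active action is optimal the concavity defect
is nonpositive, since the active cost is affine; at any other point it does not decrease when the
passive flow is applied to both arguments. The flow contracts everything to the stationary belief,
where the defect vanishes by continuity. -/
lemma IsBellmanSolution.concaveOn (h : B.IsBellmanSolution lam V g) :
    ConcaveOn ℝ (Set.Ioo 0 1) V := by
  refine ⟨convex_Ioo 0 1, fun x hx y hy a b ha hb hab => ?_⟩
  simp only [smul_eq_mul]
  by_contra! hlt
  have hmem : ∀ {x y}, x ∈ Set.Ioo (0 : ℝ) 1 → y ∈ Set.Ioo (0 : ℝ) 1 →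
      a * x + b * y ∈ Set.Ioo (0 : ℝ) 1 := fun hx hy => convex_Ioo 0 1 hx hy ha hb hab
  let D : ℝ → ℝ → ℝ := fun x y => a * V x + b * V y - V (a * x + b * y)
  have step : ∀ x ∈ Set.Ioo (0 : ℝ) 1, ∀ y ∈ Set.Ioo (0 : ℝ) 1, 0 < D x y →
      D x y ≤ D (B.tau x) (B.tau y) := by
    intro x hx y hy hD
    have hH := concaveOn_entropy2.2 hx hy ha hb hab
    simp only [smul_eq_mul] at hH
    have hz := h.eq (hmem hx hy)
    have hx' := h.eq hx
    have hy' := h.eq hy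
    simp only [D] at hD ⊢
    rw [← B.tau_combination x y hab]
    have hg : a * g + b * g = g := by rw [← add_mul, hab, one_mul]
    rcases min_cases (B.activeCost lam V (a * x + b * y)) (B.passiveCost V (a * x + b * y))
      with ⟨hm, -⟩ | ⟨hm, -⟩
    · have hxa := mul_le_mul_of_nonneg_left
        (hx'.le.trans (add_le_add_right (min_le_left _ _) _)) ha
      have hya := mul_le_mul_of_nonneg_left
        (hy'.le.trans (add_le_add_right (min_le_left _ _) _)) hb
      have hl : a * lam + b * lam = lam := by rw [← add_mul, hab, one_mul]
      rw [hm] at hz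
      simp only [activeCost] at hz hxa hya
      linarith
    · have hxa := mul_le_mul_of_nonneg_left
        (hx'.le.trans (add_le_add_right (min_le_right _ _) _)) ha
      have hya := mul_le_mul_of_nonneg_left
        (hy'.le.trans (add_le_add_right (min_le_right _ _) _)) hb
      rw [hm] at hz
      simp only [passiveCost] at hz hxa hya
      linarith
  have hD0 : 0 < D x y := sub_pos.2 hlt
  have iter : ∀ n, D x y ≤ D (B.tau^[n] x) (B.tau^[n] y) := by
    intro n
    induction n with
    | zero => exact le_rfl
    | succ n ih =>
      rw [Function.iterate_succ_apply', Function.iterate_succ_apply']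
      exact ih.trans (step _ (B.iterate_tau_mem hx n) _ (B.iterate_tau_mem hy n)
        (hD0.trans_le ih))
  set s := B.p / (B.p + B.q)
  have hV : Tendsto V (𝓝 s) (𝓝 (V s)) :=
    h.continuousOn.continuousAt (isOpen_Ioo.mem_nhds B.stationary_mem)
  have hs : a * s + b * s = s := by rw [← add_mul, hab, one_mul]
  have hz : Tendsto (fun n => a * B.tau^[n] x + b * B.tau^[n] y) atTop (𝓝 s) := by
    have := ((B.tendsto_iterate_tau x).const_mul a).add ((B.tendsto_iterate_tau y).const_mul b)
    rwa [hs] at this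
  have hlim : Tendsto (fun n => D (B.tau^[n] x) (B.tau^[n] y)) atTop
      (𝓝 (a * V s + b * V s - V s)) :=
    (((hV.comp (B.tendsto_iterate_tau x)).const_mul a).add
      ((hV.comp (B.tendsto_iterate_tau y)).const_mul b)).sub (hV.comp hz)
  have hle := ge_of_tendsto' hlim iter
  rw [← add_mul, hab, one_mul, sub_self] at hle
  exact absurd hle hD0.not_ge

lemma IsBellmanSolution.continuousOn_passiveCost (h : B.IsBellmanSolution lam V g) :
    ContinuousOn (B.passiveCost V) (Set.Icc 0 1) :=
  h.continuousOn.comp B.continuous_tau.continuousOn fun _ hx => B.tau_mem hx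

/-- Solutions are bounded: the passive flow maps `[0,1]` into a compact part of `(0,1)`. -/
lemma IsBellmanSolution.exists_bound (h : B.IsBellmanSolution lam V g) :
    ∃ M, ∀ w ∈ Set.Ioo (0 : ℝ) 1, |V w| ≤ M := by
  obtain ⟨M, hM⟩ := isCompact_Icc.exists_bound_of_continuousOn h.continuousOn_passiveCost
  refine ⟨1 + (|lam| + |V (1 - B.q)| + M) + |g|, fun w hw => ?_⟩
  have hr : |B.passiveCost V w| ≤ M := hM w (Set.Ioo_subset_Icc_self hw)
  have ha : |B.activeCost lam V w| ≤ |lam| + |V (1 - B.q)| := by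
    refine (abs_add_le _ _).trans ?_
    rw [abs_mul, abs_of_pos hw.1]
    have := mul_le_of_le_one_left (abs_nonneg (V (1 - B.q))) hw.2.le
    linarith
  have hmin : |min (B.activeCost lam V w) (B.passiveCost V w)| ≤ |lam| + |V (1 - B.q)| + M := by
    refine (abs_min_le_max_abs_abs).trans (max_le ?_ ?_)
    · linarith [abs_nonneg (B.passiveCost V w)]
    · linarith [abs_nonneg (B.activeCost lam V w)]
  have hH : |entropy2 w| ≤ 1 := abs_le.2 ⟨by linarith [entropy2_nonneg hw], entropy2_le_one w⟩
  rw [eq_sub_of_add_eq (h.eq hw)]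
  refine (abs_sub _ _).trans ?_
  linarith [abs_add_le (entropy2 w) (min (B.activeCost lam V w) (B.passiveCost V w))]

/-- The advantage of the active action is concave, and at the two certain beliefs it equals `-lam`:
there observing the chain reveals nothing. -/
lemma IsBellmanSolution.exists_thresholds (hlam : 0 ≤ lam) (h : B.IsBellmanSolution lam V g) :
    ∃ l u : ℝ, 0 ≤ l ∧ l ≤ u ∧ u ≤ 1 ∧
      (∀ w ∈ Set.Ioo (0 : ℝ) 1,
        w ∈ Set.Ioo l u ↔ B.activeCost lam V w < B.passiveCost V w) ∧
      ((∃ w ∈ Set.Icc (0 : ℝ) 1, B.activeCost lam V w ≤ B.passiveCost V w) →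
        B.activeCost lam V l = B.passiveCost V l ∧
        B.activeCost lam V u = B.passiveCost V u) := by
  have hconv : ConvexOn ℝ (Set.Icc 0 1) (B.activeCost lam V) := by
    refine ⟨convex_Icc 0 1, fun x _ y _ a b _ _ hab => le_of_eq ?_⟩
    obtain rfl : b = 1 - a := by linarith
    simp only [activeCost, smul_eq_mul]
    ring
  have hcont : Continuous (B.activeCost lam V) := by
    unfold activeCost; fun_prop
  obtain ⟨l, u, h0, hlu, h1, hiff, heq⟩ := _root_.exists_thresholds
    (f := B.passiveCost V - B.activeCost lam V)
    ((B.concaveOn_comp_tau h.concaveOn).sub hconv)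
    (h.continuousOn_passiveCost.sub hcont.continuousOn)
    (by simpa [passiveCost, activeCost, tau, h.normalized] using hlam)
    (by
      have : B.tau 1 = 1 - B.q := by unfold tau; ring
      simpa [passiveCost, activeCost, this] using hlam)
  simp only [Pi.sub_apply, sub_pos, sub_nonneg, sub_eq_zero] at hiff heq
  exact ⟨l, u, h0, hlu, h1, hiff, fun hw => ⟨(heq hw).1.symm, (heq hw).2.symm⟩⟩

end Bandit

/-! ### Expectations under discrete laws -/

/-- Expectation of a real function under a discrete law. The series converges absolutely when the
function is bounded, which is the only case used. -/
noncomputable def PMF.expectation {α : Type*} (μ : PMF α) (f : α → ℝ) : ℝ :=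
  ∑' a, (μ a).toReal * f a

namespace PMF

variable {α β : Type*}

lemma summable_toReal (μ : PMF α) : Summable fun a => (μ a).toReal :=
  ENNReal.summable_toReal μ.tsum_coe_ne_top

lemma tsum_toReal (μ : PMF α) : ∑' a, (μ a).toReal = 1 := by
  rw [← ENNReal.tsum_toReal_eq μ.apply_ne_top, μ.tsum_coe, ENNReal.toReal_one]

lemma summable_expectation (μ : PMF α) {f : α → ℝ} {M : ℝ} (hf : ∀ a, |f a| ≤ M) :
    Summable fun a => (μ a).toReal * f a := by
  refine (μ.summable_toReal.mul_right M).of_norm_bounded fun a => ?_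
  rw [Real.norm_eq_abs, abs_mul, abs_of_nonneg ENNReal.toReal_nonneg]
  exact mul_le_mul_of_nonneg_left (hf a) ENNReal.toReal_nonneg

lemma expectation_const (μ : PMF α) (c : ℝ) : μ.expectation (fun _ => c) = c := by
  rw [expectation, tsum_mul_right, tsum_toReal, one_mul]

lemma expectation_mono (μ : PMF α) {f g : α → ℝ} {M N : ℝ} (hf : ∀ a, |f a| ≤ M)
    (hg : ∀ a, |g a| ≤ N) (h : ∀ a, f a ≤ g a) : μ.expectation f ≤ μ.expectation g :=
  (μ.summable_expectation hf).tsum_le_tsum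
    (fun a => mul_le_mul_of_nonneg_left (h a) ENNReal.toReal_nonneg) (μ.summable_expectation hg)

lemma expectation_add (μ : PMF α) {f g : α → ℝ} {M N : ℝ} (hf : ∀ a, |f a| ≤ M)
    (hg : ∀ a, |g a| ≤ N) :
    μ.expectation (fun a => f a + g a) = μ.expectation f + μ.expectation g := by
  simp only [expectation, mul_add]
  exact (μ.summable_expectation hf).tsum_add (μ.summable_expectation hg)

lemma abs_expectation_le (μ : PMF α) {f : α → ℝ} {M : ℝ} (hf : ∀ a, |f a| ≤ M) :
    |μ.expectation f| ≤ M := by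
  have hM : ∀ _ : α, |M| ≤ |M| := fun _ => le_rfl
  have hM' : ∀ _ : α, |(-M)| ≤ |(-M)| := fun _ => le_rfl
  refine abs_le.2 ⟨?_, ?_⟩
  · simpa only [expectation_const] using μ.expectation_mono hM' hf fun a => (abs_le.1 (hf a)).1
  · simpa only [expectation_const] using μ.expectation_mono hf hM fun a => (abs_le.1 (hf a)).2

lemma expectation_pure (a : α) (f : α → ℝ) : (PMF.pure a).expectation f = f a := by
  rw [expectation, tsum_eq_single a]
  · simp
  · intro b hb
    simp [hb]

lemma expectation_bind (μ : PMF α) (k : α → PMF β) {f : β → ℝ} {M : ℝ} (hf : ∀ b, |f b| ≤ M) :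
    (μ.bind k).expectation f = μ.expectation fun a => (k a).expectation f := by
  have hsum : Summable fun x : α × β => (μ x.1 * k x.1 x.2).toReal := by
    refine ENNReal.summable_toReal ?_
    rw [ENNReal.tsum_prod (f := fun a b => μ a * k a b)]
    simp [ENNReal.tsum_mul_left, PMF.tsum_coe]
  have hsum' : Summable (Function.uncurry fun a b => (μ a * k a b).toReal * f b) := by
    refine (hsum.mul_right M).of_norm_bounded fun x => ?_
    rw [Function.uncurry, Real.norm_eq_abs, abs_mul, abs_of_nonneg ENNReal.toReal_nonneg]
    exact mul_le_mul_of_nonneg_left (hf x.2) ENNReal.toReal_nonneg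
  simp only [expectation, PMF.bind_apply]
  calc ∑' b, (∑' a, μ a * k a b).toReal * f b
      = ∑' b, ∑' a, (μ a * k a b).toReal * f b := by
        refine tsum_congr fun b => ?_
        rw [ENNReal.tsum_toReal_eq fun a =>
          ENNReal.mul_ne_top (μ.apply_ne_top a) ((k a).apply_ne_top b), tsum_mul_right]
    _ = ∑' a, ∑' b, (μ a * k a b).toReal * f b := hsum'.tsum_comm
    _ = ∑' a, (μ a).toReal * ∑' b, (k a b).toReal * f b := by
        refine tsum_congr fun a => ?_
        simp only [ENNReal.toReal_mul, mul_assoc, tsum_mul_left]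

lemma expectation_map (μ : PMF α) (e : α → β) {f : β → ℝ} {M : ℝ} (hf : ∀ b, |f b| ≤ M) :
    (μ.map e).expectation f = μ.expectation fun a => f (e a) := by
  rw [← PMF.bind_pure_comp, expectation_bind μ _ hf]
  simp only [Function.comp_apply, expectation_pure]

end PMF

/-! ### Optimality by telescoping the Bellman inequality -/

namespace Bandit

variable {B : Bandit} {lam : ℝ} {V : ℝ → ℝ} {g M : ℝ}

lemma expectation_transition (B : Bandit) (w : Belief) (u : Bool) {f : Belief → ℝ}
    (hf : ∀ w, |f w| ≤ M) :
    (B.transition w u).expectation f =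
      if u then w * f B.beliefQ + (1 - w) * f B.beliefP else f (B.beliefTau w) := by
  cases u
  · simp [transition, PMF.expectation_pure]
  · rw [transition, if_pos rfl, PMF.expectation_map _ _ hf, PMF.expectation, tsum_bool]
    simp [stateLaw, w.2.1.le, w.2.2.le]
    ring

/-- Bellman inequality for a single action, with equality for a minimizing action. -/
lemma IsBellmanSolution.add_le (h : B.IsBellmanSolution lam V g)
    (hV : ∀ w : Belief, |V w| ≤ M) (w : Belief) (u : Bool) :
    V w + g ≤ penalty lam (w, u) + (B.transition w u).expectation fun w' => V w' := by
  rw [B.expectation_transition w u hV, h.eq w.2]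
  cases u
  · have := min_le_right (B.activeCost lam V w) (B.passiveCost V w)
    simpa only [penalty, beliefTau, passiveCost, Bool.false_eq_true, if_false, mul_zero, add_zero]
      using add_le_add_right this (entropy2 w)
  · have := min_le_left (B.activeCost lam V w) (B.passiveCost V w)
    simp only [activeCost] at this
    simp [penalty, beliefQ, beliefP, h.normalized, activeCost]
    linarith

lemma IsBellmanSolution.add_eq (h : B.IsBellmanSolution lam V g)
    (hV : ∀ w : Belief, |V w| ≤ M) (w : Belief) (u : Bool)
    (hu : u = true ↔ B.activeCost lam V w < B.passiveCost V w) :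
    V w + g = penalty lam (w, u) + (B.transition w u).expectation fun w' => V w' := by
  rw [B.expectation_transition w u hV, h.eq w.2]
  cases u
  · have hle : B.passiveCost V w ≤ B.activeCost lam V w := by simpa using hu
    rw [min_eq_right hle]
    simp [penalty, beliefTau, passiveCost]
  · rw [min_eq_left (hu.1 rfl).le]
    simp [penalty, beliefQ, beliefP, h.normalized, activeCost]
    ring

lemma abs_penalty_le (z : Belief × Bool) : |penalty lam z| ≤ 1 + |lam| := by
  refine (abs_add_le _ _).trans (add_le_add ?_ ?_)
  · exact abs_le.2 ⟨by linarith [entropy2_nonneg z.1.2], entropy2_le_one _⟩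
  · split_ifs <;> simp

/-- Expected value of `V` at the belief of slot `t`. -/
noncomputable def expectedValue (B : Bandit) (V : ℝ → ℝ) (π : Policy) (w₀ : Belief) (t : ℕ) : ℝ :=
  (B.historyLaw π w₀ t).expectation fun x => V x.2

/-- Expected penalty of the current slot plus expected value at the next one, given the past and
the current belief. -/
noncomputable def lookahead (B : Bandit) (lam : ℝ) (V : ℝ → ℝ) (π : Policy)
    (x : List (Belief × Bool) × Belief) : ℝ :=
  (π x.1 x.2).expectation fun u =>
    penalty lam (x.2, u) + (B.transition x.2 u).expectation fun w' => V w'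

lemma abs_lookahead_le (hV : ∀ w : Belief, |V w| ≤ M) (π : Policy)
    (x : List (Belief × Bool) × Belief) : |B.lookahead lam V π x| ≤ 1 + |lam| + M :=
  PMF.abs_expectation_le _ fun _ => (abs_add_le _ _).trans
    (add_le_add (abs_penalty_le _) (PMF.abs_expectation_le _ hV))

lemma expectation_lookahead (hV : ∀ w : Belief, |V w| ≤ M) (π : Policy) (w₀ : Belief) (t : ℕ) :
    (B.historyLaw π w₀ t).expectation (B.lookahead lam V π) =
      B.expectedPenalty lam π w₀ t + B.expectedValue V π w₀ (t + 1) := by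
  have hpen : B.expectedPenalty lam π w₀ t = (B.historyLaw π w₀ t).expectation fun x =>
      (π x.1 x.2).expectation fun u => penalty lam (x.2, u) := by
    change (B.slotLaw π w₀ t).expectation (penalty lam) = _
    rw [slotLaw, PMF.expectation_bind _ _ (abs_penalty_le (lam := lam))]
    simp only [PMF.expectation_map _ _ (abs_penalty_le (lam := lam))]
  have hval : B.expectedValue V π w₀ (t + 1) = (B.historyLaw π w₀ t).expectation fun x =>
      (π x.1 x.2).expectation fun u => (B.transition x.2 u).expectation fun w' => V w' := by
    have hV' : ∀ x : List (Belief × Bool) × Belief, |V x.2| ≤ M := fun x => hV x.2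
    rw [expectedValue, historyLaw, PMF.expectation_bind _ _ hV']
    simp only [PMF.expectation_bind _ _ hV', PMF.expectation_map _ _ hV']
  rw [hpen, hval]
  refine Eq.trans ?_ (PMF.expectation_add _
    (fun x => PMF.abs_expectation_le _ fun u => abs_penalty_le (lam := lam) (x.2, u))
    (fun x => PMF.abs_expectation_le _ fun u => PMF.abs_expectation_le _ hV))
  congr 1
  funext x
  exact PMF.expectation_add _ (fun u => abs_penalty_le (x.2, u))
    (fun u => PMF.abs_expectation_le _ hV)

lemma expectation_add_const (hV : ∀ w : Belief, |V w| ≤ M) (π : Policy) (w₀ : Belief) (t : ℕ) :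
    (B.historyLaw π w₀ t).expectation (fun x => V x.2 + g) = B.expectedValue V π w₀ t + g := by
  refine (PMF.expectation_add (f := fun x : List (Belief × Bool) × Belief => V x.2) _
    (fun x => hV x.2) (fun _ => le_refl |g|)).trans ?_
  rw [PMF.expectation_const, expectedValue]

lemma IsBellmanSolution.expectedValue_add_le (h : B.IsBellmanSolution lam V g)
    (hV : ∀ w : Belief, |V w| ≤ M) (π : Policy) (w₀ : Belief) (t : ℕ) :
    B.expectedValue V π w₀ t + g ≤
      B.expectedPenalty lam π w₀ t + B.expectedValue V π w₀ (t + 1) := by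
  rw [← expectation_lookahead hV, ← expectation_add_const hV]
  refine PMF.expectation_mono _ (N := 1 + |lam| + M)
    (fun x => (abs_add_le _ _).trans (add_le_add_left (hV x.2) |g|))
    (abs_lookahead_le hV π) fun x => ?_
  rw [← PMF.expectation_const (π x.1 x.2) (V x.2 + g)]
  exact PMF.expectation_mono _ (fun _ => le_rfl)
    (fun u => (abs_add_le _ _).trans
      (add_le_add (abs_penalty_le _) (PMF.abs_expectation_le _ hV)))
    fun u => h.add_le hV x.2 u

lemma IsBellmanSolution.expectedValue_add_eq (h : B.IsBellmanSolution lam V g)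
    (hV : ∀ w : Belief, |V w| ≤ M) {l u : ℝ}
    (hlu : ∀ w ∈ Set.Ioo (0 : ℝ) 1,
      w ∈ Set.Ioo l u ↔ B.activeCost lam V w < B.passiveCost V w) (w₀ : Belief) (t : ℕ) :
    B.expectedValue V (thresholdPolicy l u) w₀ t + g =
      B.expectedPenalty lam (thresholdPolicy l u) w₀ t
        + B.expectedValue V (thresholdPolicy l u) w₀ (t + 1) := by
  rw [← expectation_lookahead hV, ← expectation_add_const hV]
  congr 1
  funext x
  rw [lookahead, thresholdPolicy, PMF.expectation_pure]
  exact h.add_eq hV _ _ (by rw [decide_eq_true_iff]; exact hlu _ x.2.2)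

lemma abs_expectedValue_le (hV : ∀ w : Belief, |V w| ≤ M) (π : Policy) (w₀ : Belief) (t : ℕ) :
    |B.expectedValue V π w₀ t| ≤ M :=
  PMF.abs_expectation_le _ fun x => hV x.2

/-- By telescoping, the average penalty over `T` slots is at least `g - 2M/T`. -/
lemma IsBellmanSolution.le_averagePenalty (h : B.IsBellmanSolution lam V g)
    (hV : ∀ w : Belief, |V w| ≤ M) (π : Policy) (w₀ : Belief) {T : ℕ} (hT : 0 < T) :
    g - 2 * M / T ≤ B.averagePenalty lam π w₀ T := by
  have hT' : (0 : ℝ) < T := Nat.cast_pos.2 hT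
  have hsum : T * g + B.expectedValue V π w₀ 0 ≤
      (∑ t ∈ Finset.range T, B.expectedPenalty lam π w₀ t) + B.expectedValue V π w₀ T := by
    clear hT hT'
    induction T with
    | zero => simp
    | succ n ih =>
      rw [Finset.sum_range_succ]
      push_cast
      linarith [h.expectedValue_add_le hV π w₀ n]
  rw [averagePenalty, le_div_iff₀ hT', sub_mul, div_mul_cancel₀ _ hT'.ne']
  linarith [abs_le.1 (abs_expectedValue_le (B := B) hV π w₀ 0),
    abs_le.1 (abs_expectedValue_le (B := B) hV π w₀ T)]

lemma IsBellmanSolution.averagePenalty_le (h : B.IsBellmanSolution lam V g)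
    (hV : ∀ w : Belief, |V w| ≤ M) {l u : ℝ}
    (hlu : ∀ w ∈ Set.Ioo (0 : ℝ) 1,
      w ∈ Set.Ioo l u ↔ B.activeCost lam V w < B.passiveCost V w) (w₀ : Belief) {T : ℕ}
    (hT : 0 < T) : B.averagePenalty lam (thresholdPolicy l u) w₀ T ≤ g + 2 * M / T := by
  have hT' : (0 : ℝ) < T := Nat.cast_pos.2 hT
  have hsum : (∑ t ∈ Finset.range T, B.expectedPenalty lam (thresholdPolicy l u) w₀ t)
      + B.expectedValue V (thresholdPolicy l u) w₀ T
      = T * g + B.expectedValue V (thresholdPolicy l u) w₀ 0 := by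
    clear hT hT'
    induction T with
    | zero => simp
    | succ n ih =>
      rw [Finset.sum_range_succ]
      push_cast
      linarith [h.expectedValue_add_eq hV hlu w₀ n]
  rw [averagePenalty, div_le_iff₀ hT', add_mul, div_mul_cancel₀ _ hT'.ne']
  linarith [abs_le.1 (abs_expectedValue_le (B := B) hV (thresholdPolicy l u) w₀ 0),
    abs_le.1 (abs_expectedValue_le (B := B) hV (thresholdPolicy l u) w₀ T)]

lemma IsBellmanSolution.isAverageOptimal (h : B.IsBellmanSolution lam V g) {l u : ℝ}
    (hlu : ∀ w ∈ Set.Ioo (0 : ℝ) 1,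
      w ∈ Set.Ioo l u ↔ B.activeCost lam V w < B.passiveCost V w) :
    B.IsAverageOptimal lam (thresholdPolicy l u) g := by
  obtain ⟨M, hM⟩ := h.exists_bound
  have hV : ∀ w : Belief, |V w| ≤ M := fun w => hM w w.2
  have hlim : Tendsto (fun T : ℕ => 2 * M / (T : ℝ)) atTop (𝓝 0) :=
    tendsto_const_div_atTop_nhds_zero_nat (2 * M)
  refine fun w₀ => ⟨?_, fun π ε hε => ?_⟩
  · refine tendsto_of_tendsto_of_tendsto_of_le_of_le'
      (by simpa using hlim.const_sub g) (by simpa using hlim.const_add g) ?_ ?_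
    · filter_upwards [eventually_gt_atTop 0] with T hT using h.le_averagePenalty hV _ w₀ hT
    · filter_upwards [eventually_gt_atTop 0] with T hT using h.averagePenalty_le hV hlu w₀ hT
  · filter_upwards [eventually_gt_atTop 0, hlim.eventually_lt_const hε] with T hT hTε
    linarith [h.le_averagePenalty hV π w₀ hT]

end Bandit

/-! ### Existence of a solution by vanishing discount -/

namespace Bandit

variable {B : Bandit} {lam β : ℝ}

/-- Value iteration with discount factor `β`: optimal discounted penalty over `n` slots. -/
noncomputable def valueIter (B : Bandit) (lam β : ℝ) : ℕ → ℝ → ℝ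
  | 0, _ => 0
  | n + 1, w => entropy2 w +
      min (lam + β * (w * valueIter B lam β n (1 - B.q) + (1 - w) * valueIter B lam β n B.p))
        (β * valueIter B lam β n (B.tau w))

lemma valueIter_nonneg (hlam : 0 ≤ lam) (hβ : 0 ≤ β) (n : ℕ) :
    ∀ w ∈ Set.Ioo (0 : ℝ) 1, 0 ≤ B.valueIter lam β n w := by
  induction n with
  | zero => intro w _; exact le_rfl
  | succ n ih =>
    intro w hw
    refine add_nonneg (entropy2_nonneg hw) (le_min (add_nonneg hlam (mul_nonneg hβ
      (add_nonneg (mul_nonneg hw.1.le (ih _ B.one_sub_q_mem))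
        (mul_nonneg (sub_nonneg.2 hw.2.le) (ih _ B.p_mem)))))
      (mul_nonneg hβ (ih _ (B.tau_mem_Ioo hw))))

lemma valueIter_le_succ (hlam : 0 ≤ lam) (hβ : 0 ≤ β) (n : ℕ) :
    ∀ w ∈ Set.Ioo (0 : ℝ) 1, B.valueIter lam β n w ≤ B.valueIter lam β (n + 1) w := by
  induction n with
  | zero => exact valueIter_nonneg hlam hβ 1
  | succ n ih =>
    intro w hw
    have h1 := ih _ B.one_sub_q_mem
    have h2 := ih _ B.p_mem
    have h3 := ih _ (B.tau_mem_Ioo hw)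
    have hw0 := hw.1.le
    have hw1 := sub_nonneg.2 hw.2.le
    rw [valueIter, valueIter]
    gcongr

lemma valueIter_le (hlam : 0 ≤ lam) (hβ : 0 ≤ β) (hβ1 : β < 1) (n : ℕ) :
    ∀ w ∈ Set.Ioo (0 : ℝ) 1, B.valueIter lam β n w ≤ (1 + lam) / (1 - β) := by
  have hβ' : 0 < 1 - β := sub_pos.2 hβ1
  induction n with
  | zero => intro w _; exact div_nonneg (by linarith) hβ'.le
  | succ n ih =>
    intro w hw
    have h3 := mul_le_mul_of_nonneg_left (ih _ (B.tau_mem_Ioo hw)) hβ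
    have hH := entropy2_le_one w
    have hmin := min_le_right
      (lam + β * (w * B.valueIter lam β n (1 - B.q) + (1 - w) * B.valueIter lam β n B.p))
      (β * B.valueIter lam β n (B.tau w))
    have heq : (1 + lam) / (1 - β) = 1 + lam + β * ((1 + lam) / (1 - β)) := by
      field_simp
      ring
    rw [valueIter, heq]
    linarith

lemma concaveOn_valueIter (hβ : 0 ≤ β) (n : ℕ) :
    ConcaveOn ℝ (Set.Ioo 0 1) (B.valueIter lam β n) := by
  induction n with
  | zero => exact concaveOn_const 0 (convex_Ioo 0 1)
  | succ n ih =>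
    refine concaveOn_entropy2.add (ConcaveOn.inf ?_ ?_)
    · refine ⟨convex_Ioo 0 1, fun x _ y _ a b _ _ hab => le_of_eq ?_⟩
      obtain rfl : b = 1 - a := by linarith
      simp only [smul_eq_mul]
      ring
    · exact ((B.concaveOn_comp_tau ih).subset Set.Ioo_subset_Icc_self (convex_Ioo 0 1)).smul hβ

/-- The discounted value function, obtained as the increasing limit of value iteration. -/
lemma exists_discounted (B : Bandit) (hlam : 0 ≤ lam) (hβ : 0 ≤ β) (hβ1 : β < 1) :
    ∃ V : ℝ → ℝ, ConcaveOn ℝ (Set.Ioo 0 1) V ∧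
      (∀ w ∈ Set.Ioo (0 : ℝ) 1, 0 ≤ V w ∧ (1 - β) * V w ≤ 1 + lam) ∧
      ∀ w ∈ Set.Ioo (0 : ℝ) 1, V w = entropy2 w +
        min (lam + β * (w * V (1 - B.q) + (1 - w) * V B.p)) (β * V (B.tau w)) := by
  have hlim : ∀ w ∈ Set.Ioo (0 : ℝ) 1, Tendsto (fun n => B.valueIter lam β n w) atTop
      (𝓝 (⨆ n, B.valueIter lam β n w)) := fun w hw =>
    tendsto_atTop_ciSup (monotone_nat_of_le_succ fun n => valueIter_le_succ hlam hβ n w hw)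
      ⟨_, Set.forall_mem_range.2 fun n => valueIter_le hlam hβ hβ1 n w hw⟩
  refine ⟨fun w => ⨆ n, B.valueIter lam β n w,
    concaveOn_of_tendsto (convex_Ioo 0 1) (concaveOn_valueIter hβ) hlim, fun w hw => ⟨?_, ?_⟩,
    fun w hw => ?_⟩
  · exact ge_of_tendsto' (hlim w hw) fun n => valueIter_nonneg hlam hβ n w hw
  · rw [mul_comm, ← le_div_iff₀ (sub_pos.2 hβ1)]
    exact le_of_tendsto' (hlim w hw) fun n => valueIter_le hlam hβ hβ1 n w hw
  · refine tendsto_nhds_unique ((hlim w hw).comp (tendsto_add_atTop_nat 1)) ?_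
    exact ((((((hlim _ B.one_sub_q_mem).const_mul w).add
      ((hlim _ B.p_mem).const_mul (1 - w))).const_mul β).const_add lam).min
      ((hlim _ (B.tau_mem_Ioo hw)).const_mul β)).const_add _

/-- The discounted value function relative to its value at `p` is bounded uniformly in the
discount factor. From `p` and from `1 - q`, the active action reaches the other of these two
beliefs with positive probability, so their values differ by a bounded amount; concavity then
bounds the function from below between them, and one passive step leads there. -/
lemma exists_relative_discounted (B : Bandit) (hlam : 0 ≤ lam) (hβ : 0 ≤ β) (hβ1 : β < 1) :
    ∃ (h : ℝ → ℝ) (g : ℝ), ConcaveOn ℝ (Set.Ioo 0 1) h ∧ h B.p = 0 ∧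
      g ∈ Set.Icc 0 (1 + lam) ∧
      (∀ w ∈ Set.Ioo (0 : ℝ) 1, h w ∈ Set.Icc (-(1 + lam) - (1 + lam) / B.p)
        ((1 + lam) + (1 + lam) / B.q)) ∧
      ∀ w ∈ Set.Ioo (0 : ℝ) 1, h w + g = entropy2 w +
        min (lam + β * (w * h (1 - B.q))) (β * h (B.tau w)) := by
  obtain ⟨V, hconc, hbd, heq⟩ := B.exists_discounted hlam hβ hβ1
  have hp0 := B.p_pos
  have hq0 : 0 < B.q := hp0.trans_le B.p_le_q
  have hC : 0 ≤ 1 + lam := by linarith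
  have hVp := hbd _ B.p_mem
  have hVq := hbd _ B.one_sub_q_mem
  have active : ∀ w ∈ Set.Ioo (0 : ℝ) 1,
      V w ≤ 1 + lam + (w * V (1 - B.q) + (1 - w) * V B.p) := by
    intro w hw
    have hnn : 0 ≤ w * V (1 - B.q) + (1 - w) * V B.p :=
      add_nonneg (mul_nonneg hw.1.le hVq.1) (mul_nonneg (sub_nonneg.2 hw.2.le) hVp.1)
    have := min_le_left (lam + β * (w * V (1 - B.q) + (1 - w) * V B.p)) (β * V (B.tau w))
    have h2 := mul_le_of_le_one_left hnn hβ1.le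
    have h3 := entropy2_le_one w
    rw [heq w hw]
    linarith
  have hqp : V (1 - B.q) - V B.p ≤ (1 + lam) / B.q := by
    rw [le_div_iff₀ hq0]
    have := active _ B.one_sub_q_mem
    nlinarith
  have hpq : V B.p - V (1 - B.q) ≤ (1 + lam) / B.p := by
    rw [le_div_iff₀ hp0]
    have := active _ B.p_mem
    nlinarith
  have hCp : 0 ≤ (1 + lam) / B.p := div_nonneg hC hp0.le
  have hCq : 0 ≤ (1 + lam) / B.q := div_nonneg hC hq0.le
  refine ⟨fun w => V w - V B.p, (1 - β) * V B.p, hconc.sub (convexOn_const _ (convex_Ioo 0 1)),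
    sub_self _, ⟨mul_nonneg (sub_nonneg.2 hβ1.le) hVp.1, hVp.2⟩, fun w hw => ⟨?_, ?_⟩,
    fun w hw => ?_⟩
  · have hmix : V B.p - (1 + lam) / B.p ≤ w * V (1 - B.q) + (1 - w) * V B.p := by
      nlinarith [mul_nonneg hw.1.le (sub_nonneg.2 hpq), mul_nonneg (sub_nonneg.2 hw.2.le) hCp]
    have htau : V B.p - (1 + lam) / B.p ≤ V (B.tau w) := by
      have := hconc.2 B.one_sub_q_mem B.p_mem hw.1.le (sub_nonneg.2 hw.2.le) (by ring)
      simp only [smul_eq_mul] at this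
      rw [B.tau_eq_combination]
      exact hmix.trans this
    have hmin : β * (V B.p - (1 + lam) / B.p) ≤
        min (lam + β * (w * V (1 - B.q) + (1 - w) * V B.p)) (β * V (B.tau w)) := by
      refine le_min ?_ (mul_le_mul_of_nonneg_left htau hβ)
      linarith [mul_le_mul_of_nonneg_left hmix hβ]
    have hH := entropy2_nonneg hw
    have h1 := mul_le_of_le_one_left hCp hβ1.le
    simp only
    rw [heq w hw]
    linarith [hVp.2]
  · have h1 := active w hw
    have h2 := mul_le_mul_of_nonneg_left hqp hw.1.le
    have h3 := mul_le_of_le_one_left hCq hw.2.le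
    simp only
    linarith
  · have h1 : lam + β * (w * V (1 - B.q) + (1 - w) * V B.p) =
        lam + β * (w * (V (1 - B.q) - V B.p)) + β * V B.p := by ring
    have h2 : β * V (B.tau w) = β * (V (B.tau w) - V B.p) + β * V B.p := by ring
    have := heq w hw
    rw [h1, h2, min_add_add_right] at this
    simp only
    linarith

/-- Along an ultrafilter of discount factors tending to `1`, the bounded relative values converge
pointwise, without any appeal to equicontinuity: the limit is concave, hence continuous on the
open interval. -/
lemma exists_isBellmanSolution (B : Bandit) (hlam : 0 ≤ lam) :
    ∃ (V : ℝ → ℝ) (g : ℝ), B.IsBellmanSolution lam V g := by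
  have hβ0 : ∀ n : ℕ, 0 ≤ 1 - 1 / ((n : ℝ) + 1) := fun n => by
    rw [sub_nonneg, div_le_one (by positivity)]
    linarith [n.cast_nonneg (α := ℝ)]
  have hβ1 : ∀ n : ℕ, 1 - 1 / ((n : ℝ) + 1) < 1 := fun n => sub_lt_self _ (by positivity)
  choose h g hconc hp hg hbd heq using fun n => B.exists_relative_discounted hlam (hβ0 n) (hβ1 n)
  have hβ : Tendsto (fun n : ℕ => 1 - 1 / ((n : ℝ) + 1)) (hyperfilter ℕ) (𝓝 1) := by
    have := (tendsto_one_div_add_atTop_nhds_zero_nat (𝕜 := ℝ)).const_sub 1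
    rw [sub_zero] at this
    exact this.mono_left Nat.hyperfilter_le_atTop
  have compact : ∀ (f : ℕ → ℝ) (a b : ℝ), (∀ n, f n ∈ Set.Icc a b) →
      ∃ x, Tendsto f (hyperfilter ℕ) (𝓝 x) := fun f a b hf => by
    obtain ⟨x, -, hx⟩ := (isCompact_Icc (a := a) (b := b)).ultrafilter_le_nhds
      ((hyperfilter ℕ).map f) (le_principal_iff.2 (Ultrafilter.mem_map.2 (univ_mem' hf)))
    exact ⟨x, hx⟩
  obtain ⟨g', hg'⟩ := compact g _ _ hg
  choose! V hV using fun w (hw : w ∈ Set.Ioo (0 : ℝ) 1) =>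
    compact (fun n => h n w) _ _ fun n => hbd n w hw
  have hVp : V B.p = 0 := tendsto_nhds_unique (hV _ B.p_mem) (by simp only [hp]; exact
    tendsto_const_nhds)
  refine ⟨V, g', (concaveOn_of_tendsto (convex_Ioo 0 1) hconc hV).continuousOn isOpen_Ioo, hVp,
    fun w hw => ?_⟩
  rw [hVp, mul_zero, add_zero]
  refine tendsto_nhds_unique ((hV w hw).add hg') ?_
  simp only [heq _ w hw]
  have hlim := (((hβ.mul ((hV _ B.one_sub_q_mem).const_mul w)).const_add lam).min
    (hβ.mul (hV _ (B.tau_mem_Ioo hw)))).const_add (entropy2 w)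
  rwa [one_mul, one_mul] at hlim

end Bandit

theorem proposition1 (B : Bandit) (lam : ℝ) (hlam : 0 ≤ lam) :
    (∃ (V : ℝ → ℝ) (g : ℝ), B.IsBellmanSolution lam V g) ∧
    ∀ (V : ℝ → ℝ) (g : ℝ), B.IsBellmanSolution lam V g →
      ∃ l u : ℝ, 0 ≤ l ∧ l ≤ u ∧ u ≤ 1 ∧
        B.IsAverageOptimal lam (Bandit.thresholdPolicy l u) g ∧
        (∀ w ∈ Set.Ioo (0 : ℝ) 1,
          w ∈ Set.Ioo l u ↔ B.activeCost lam V w < B.passiveCost V w) ∧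
        ((∃ w ∈ Set.Icc (0 : ℝ) 1, B.activeCost lam V w ≤ B.passiveCost V w) →
          B.activeCost lam V l = B.passiveCost V l ∧
          B.activeCost lam V u = B.passiveCost V u) ∧
        (Set.Ioo l u = ∅ → Bandit.thresholdPolicy l u = Bandit.neverSample) := by
  refine ⟨B.exists_isBellmanSolution hlam, fun V g h => ?_⟩
  obtain ⟨l, u, h0, hlu, h1, hiff, heq⟩ := h.exists_thresholds hlam
  refine ⟨l, u, h0, hlu, h1, h.isAverageOptimal hiff, hiff, heq, fun hempty => ?_⟩
  funext _ w
  simp [Bandit.thresholdPolicy, Bandit.neverSample, hempty]
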